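/- Let $n \ge 0$. Words are over the alphabet $\mathbb{N}$ with its usual order, and $\mathfrak{S}_n$ is the set of permutations of $\{1,\dots,n\}$, written as words $\sigma_1\cdots\sigma_n$. The (right) permutohedron order $\le_P$ on $\mathfrak{S}_n$ is the partial order generated by $u\,ab\,v \lessdot u\,ba\,v$ for letters $a<b$ and words $u,v$. The Baxter congruence $\equiv_B$ is the smallest monoid congruence on words such that $$c\,u\,ad\,v\,b \equiv_B c\,u\,da\,v\,b \quad (a\le b<c\le d), \qquad b\,u\,da\,v\,c \equiv_B b\,u\,ad\,v\,c \quad (a<b\le c<d)$$ for all words $u,v$ and letters $a,b,c,d$. The canopy of a binary tree is the word obtained by reading its leaves from left to right, except the first and the last one, writing $0$ for a leaf that is a right child and $1$ for a leaf that is a left child. Let $\mathcal{TBT}_n$ be the set of pairs of twin binary trees with $n$ nodes, that is, pairs $(T_L,T_R)$ of binary trees with $n$ (internal) nodes each whose canopies differ at every position. The $\mathbb{P}$-symbol of $\sigma\in\mathfrak{S}_n$ is the pair of binary trees obtained, after forgetting labels, by starting from two empty trees and inserting $\sigma_1,\dots,\sigma_n$ in this order into both: into the left tree by leaf insertion (the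 letter $a$ goes to the left subtree of a node labeled $b$ if $a<b$ and to the right subtree otherwise, until it reaches a leaf, where it becomes a new node), into the right tree $T$ by root insertion (the result has root $a$, left subtree $T_{\le a}$ and right subtree $T_{>a}$, where $T_{\le a}$ and $T_{>a}$ are the binary search trees formed by the nodes of $T$ with labels $\le a$ and $>a$, respectively, in which an ancestor of a node is also its ancestor in $T$). For $J_0,J_1\in\mathcal{TBT}_n$ put $J_0\le_B J_1$ if there are $\sigma_0,\sigma_1\in\mathfrak{S}_n$ with $\mathbb{P}(\sigma_0)=J_0$, $\mathbb{P}(\sigma_1)=J_1$ and $\sigma_0\le_P\sigma_1$. Proposition. For every $n\ge 0$, the relation $\le_B$ is a partial order on $\mathcal{TBT}_n$, and the poset $(\mathcal{TBT}_n,\le_B)$ is a lattice. Moreover, $(\mathfrak{S}_n,\le_P)$ is a lattice, and the restriction of $\equiv_B$ to $\mathfrak{S}_n$ is a lattice congruence of it. -/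

import Mathlib

namespace Baxter

/-! ### Permutations as words and the right permutohedron order -/

/-- The permutation `σ` of size `n` written as the word `σ₁ σ₂ … σₙ` on the letters `1, …, n`. -/
def word {n : ℕ} (σ : Equiv.Perm (Fin n)) : List ℕ :=
  List.ofFn fun i => (σ i : ℕ) + 1

/-- `σ = u a b v` and `ν = u b a v` for some words `u, v` and some letters `a < b`. -/
def PermCover {n : ℕ} (σ ν : Equiv.Perm (Fin n)) : Prop :=
  ∃ (u v : List ℕ) (a b : ℕ), a < b ∧
    word σ = u ++ [a, b] ++ v ∧ word ν = u ++ [b, a] ++ v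

/-- The (right) permutohedron order on permutations of size `n`: the reflexive and transitive
closure of its covering relation. -/
def PermLE {n : ℕ} (σ ν : Equiv.Perm (Fin n)) : Prop :=
  Relation.ReflTransGen PermCover σ ν

/-! ### The Baxter congruence -/

/-- The two adjacency relations `c u a d v b ⇌ c u d a v b` (where `a ≤ b < c ≤ d`) and
`b u d a v c ⇌ b u a d v c` (where `a < b ≤ c < d`) on words. -/
inductive Adj : FreeMonoid ℕ → FreeMonoid ℕ → Prop
  | first (u v : List ℕ) (a b c d : ℕ) (hab : a ≤ b) (hbc : b < c) (hcd : c ≤ d) :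
      Adj (FreeMonoid.ofList ([c] ++ u ++ [a, d] ++ v ++ [b]))
        (FreeMonoid.ofList ([c] ++ u ++ [d, a] ++ v ++ [b]))
  | second (u v : List ℕ) (a b c d : ℕ) (hab : a < b) (hbc : b ≤ c) (hcd : c < d) :
      Adj (FreeMonoid.ofList ([b] ++ u ++ [d, a] ++ v ++ [c]))
        (FreeMonoid.ofList ([b] ++ u ++ [a, d] ++ v ++ [c]))

/-- The Baxter congruence on the free monoid over the alphabet `ℕ`: the smallest monoid
congruence containing the adjacency relations. -/
def con : Con (FreeMonoid ℕ) := conGen Adj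

/-- Two permutations of the same size are Baxter equivalent if their words are congruent. -/
def PermEquiv {n : ℕ} (σ ν : Equiv.Perm (Fin n)) : Prop :=
  con (FreeMonoid.ofList (word σ)) (FreeMonoid.ofList (word ν))

/-! ### Pairs of twin binary trees -/

/-- The orientations of the leaves of a binary tree from left to right: `true` (the letter `1`)
for a left-oriented leaf, that is, a left child, and `false` (the letter `0`) for a right-oriented
one. The argument `o` is the orientation given to the leaf if the tree is a single leaf. -/
def leafWord (o : Bool) : BinaryTree Unit → List Bool
  | .nil => [o]
  | .node _ l r => leafWord true l ++ leafWord false r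

/-- The canopy of a binary tree: its leaf orientations, without the first and the last leaf. -/
def canopy (T : BinaryTree Unit) : List Bool :=
  (leafWord true T).tail.dropLast

/-- Pairs of twin binary trees with `n` nodes each: pairs whose canopies differ letterwise. -/
@[ext]
structure TwinTrees (n : ℕ) where
  left : BinaryTree Unit
  right : BinaryTree Unit
  left_numNodes : left.numNodes = n
  right_numNodes : right.numNodes = n
  twin : List.Forall₂ (· ≠ ·) (canopy left) (canopy right)

/-! ### The insertion algorithm -/

/-- Leaf insertion of the letter `a` into a left binary search tree. -/
def leafInsert (a : ℕ) : BinaryTree ℕ → BinaryTree ℕ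
  | .nil => .node a .nil .nil
  | .node b l r => if a < b then .node b (leafInsert a l) r else .node b l (leafInsert a r)

/-- The restriction of a right binary search tree to its nodes with labels at most `b`, with the
ancestor relation it inherits. (If the label of the root is at most `b`, so are all the labels of
its left subtree; otherwise all the labels of its right subtree exceed `b`.) -/
def lowerRestrict (b : ℕ) : BinaryTree ℕ → BinaryTree ℕ
  | .nil => .nil
  | .node x l r => if x ≤ b then .node x l (lowerRestrict b r) else lowerRestrict b l

/-- The restriction of a right binary search tree to its nodes with labels greater than `b`, with
the ancestor relation it inherits. -/
def higherRestrict (b : ℕ) : BinaryTree ℕ → BinaryTree ℕ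
  | .nil => .nil
  | .node x l r => if b < x then .node x (higherRestrict b l) r else higherRestrict b r

/-- Root insertion of the letter `a` into a right binary search tree. -/
def rootInsert (a : ℕ) (T : BinaryTree ℕ) : BinaryTree ℕ :=
  .node a (lowerRestrict a T) (higherRestrict a T)

/-- The `P`-symbol of a word: starting from a pair of empty trees, its letters are inserted from
left to right, by leaf insertion into the left tree and root insertion into the right tree. -/
def pSymbol (w : List ℕ) : BinaryTree ℕ × BinaryTree ℕ :=
  w.foldl (fun T a => (leafInsert a T.1, rootInsert a T.2)) (.nil, .nil)

/-- The unlabeled binary tree obtained by forgetting the labels. -/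
def shape (T : BinaryTree ℕ) : BinaryTree Unit := T.map fun _ => ()

/-- The (shape of the) `P`-symbol of the permutation `σ` is the pair of twin binary trees `J`. -/
def HasPSymbol {n : ℕ} (σ : Equiv.Perm (Fin n)) (J : TwinTrees n) : Prop :=
  shape (pSymbol (word σ)).1 = J.left ∧ shape (pSymbol (word σ)).2 = J.right

/-! ### The Baxter order -/

/-- `J₀ ≤ J₁` if there are permutations `σ₀ ≤ σ₁` in the permutohedron order whose `P`-symbols
are `J₀` and `J₁`. -/
def TwinLE {n : ℕ} (J₀ J₁ : TwinTrees n) : Prop :=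
  ∃ σ₀ σ₁ : Equiv.Perm (Fin n), HasPSymbol σ₀ J₀ ∧ HasPSymbol σ₁ J₁ ∧ PermLE σ₀ σ₁

end Baxter

/-!
The proof compares permutations through their inversions and through the first and last letters of
intervals of letters.

*The weak order.* `PermLE` is inclusion of inversion sets (`permLE_iff_le`): below `ν`, any other
`σ` has an ascent that `ν` inverts. A set of pairs `a < b` is an inversion set as soon as it is
transitive and cotransitive (`exists_inv_iff`), and the transitive closure of a cotransitive set is
one (`exists_inv_iff_transGen`). This applied to a union of two inversion sets gives joins; meets
come from the complement `a ↦ n + 1 - a`, which reverses the order.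

*The Baxter congruence.* On permutations it is generated by swaps of two consecutive letters `a < d`
for which some letter between `a` and `d` in value precedes them and another one follows them
(`permEquiv_iff_baxterEquiv`). Such a swap preserves the statements "`a` is the first (or the last)
letter of `σ` among those between `a` and `c`" (`First`, `Last`). The preorder `DataLe` compares two
permutations by half of these statements. It contains the weak order, and for a `τ` without Baxter
step upwards, `DataLe σ τ` already gives `σ ≤ τ` (`le_of_dataLe_of_forall_not`). Hence `DataLe` is
the order of the Baxter classes: its symmetric part is the Baxter equivalence, and `σ` is below `τ`
for it if and only if `σ` is below some permutation equivalent to `τ`. Since it is compatible with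
joins (`dataLe_sup`) and reversed by complements, the equivalence is a lattice congruence.

*Twin trees.* The left tree of the `P`-symbol is the binary search tree of the word and the right
one that of the reversed word. In the binary search tree of a word, with nodes labeled in infix
order, `a` is an ancestor of `c` exactly when `a` is the first letter among those between `a` and
`c` (`anc_leafTree`), and the ancestor relation determines the tree (`eq_of_anc_imp`). So the
`P`-symbol is a complete invariant of the Baxter classes. The canopy tells, for each `i`, which of
`i` and `i + 1` is an ancestor of the other one, so that `P`-symbols are twin. Conversely, for twin
trees, the transitive closure of the inversions forced by the two trees is the inversion set of a
permutation with these trees as its `P`-symbol (`exists_perm_hasPSymbol`). The lattice structure on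
pairs of twin trees is then the one on the Baxter classes.
-/

namespace Baxter

open Equiv

variable {n : ℕ}

/-! ### Inversions and the weak order -/

/-- `(a, b)` is an inversion of `σ`: the letters `a < b` are such that `b` precedes `a` in `σ`. -/
def Inv (σ : Perm (Fin n)) (a b : Fin n) : Prop := a < b ∧ σ.symm b < σ.symm a

theorem Inv.trans {σ : Perm (Fin n)} {a b c : Fin n} (h : Inv σ a b) (h' : Inv σ b c) :
    Inv σ a c :=
  ⟨h.1.trans h'.1, h'.2.trans h.2⟩

theorem Inv.cotrans {σ : Perm (Fin n)} {a b c : Fin n} (h : Inv σ a c) (hab : a < b)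
    (hbc : b < c) : Inv σ a b ∨ Inv σ b c := by
  rcases lt_or_ge (σ.symm b) (σ.symm a) with h1 | h1
  · exact .inl ⟨hab, h1⟩
  · exact .inr ⟨hbc, h.2.trans_le h1⟩

theorem not_inv {σ : Perm (Fin n)} {a b : Fin n} (h : a < b) :
    ¬ Inv σ a b ↔ σ.symm a < σ.symm b := by
  have : σ.symm a ≠ σ.symm b := fun e => h.ne (σ.symm.injective e)
  simp only [Inv, h, true_and, not_lt]
  exact ⟨fun h => lt_of_le_of_ne h this, le_of_lt⟩

theorem inv_mul_swap {σ : Perm (Fin n)} {i j : Fin n} (hij : (i : ℕ) + 1 = j) (hσ : σ i < σ j)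
    (a b : Fin n) : Inv (σ * swap i j) a b ↔ Inv σ a b ∨ (a = σ i ∧ b = σ j) := by
  obtain ⟨p, rfl⟩ := σ.surjective a
  obtain ⟨q, rfl⟩ := σ.surjective b
  have h : ∀ x, (σ * swap i j).symm (σ x) = swap i j x := by
    intro x
    rw [Equiv.symm_apply_eq]
    simp
  simp only [Inv, h, symm_apply_apply, EmbeddingLike.apply_eq_iff_eq, swap_apply_def]
  constructor
  · rintro ⟨h1, h2⟩
    split_ifs at h2 <;> simp_all <;> omega
  · rintro (⟨h1, h2⟩ | ⟨rfl, rfl⟩)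
    · refine ⟨h1, ?_⟩
      have : ¬ (p = j ∧ q = i) := by
        rintro ⟨rfl, rfl⟩
        exact lt_asymm h1 hσ
      split_ifs <;> simp_all <;> omega
    · refine ⟨hσ, ?_⟩
      have : q ≠ p := by rintro rfl; omega
      simp [this]
      omega

/-- One step upwards in the weak order: a swap of two letters in consecutive positions that
stand in increasing order. -/
def Up (σ ν : Perm (Fin n)) : Prop :=
  ∃ i j : Fin n, (i : ℕ) + 1 = j ∧ σ i < σ j ∧ ν = σ * swap i j

/-- The weak order on permutations, as inclusion of inversion sets. -/
def Le (σ ν : Perm (Fin n)) : Prop := ∀ a b, Inv σ a b → Inv ν a b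

theorem Le.refl (σ : Perm (Fin n)) : Le σ σ := fun _ _ h => h

theorem Le.trans {σ ν τ : Perm (Fin n)} (h : Le σ ν) (h' : Le ν τ) : Le σ τ :=
  fun a b hab => h' a b (h a b hab)

theorem Up.le {σ ν : Perm (Fin n)} (h : Up σ ν) : Le σ ν := by
  obtain ⟨i, j, hij, hσ, rfl⟩ := h
  exact fun a b hab => (inv_mul_swap hij hσ a b).2 (.inl hab)

theorem eq_of_forall_adjacent {σ ν : Perm (Fin n)}
    (h : ∀ i j : Fin n, (i : ℕ) + 1 = j → ν.symm (σ i) < ν.symm (σ j)) : σ = ν := by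
  have hm : StrictMono fun i => ν.symm (σ i) := by
    cases n with
    | zero => exact fun i => i.elim0
    | succ n => exact Fin.strictMono_iff_lt_succ.2 fun i => h _ _ (by simp)
  have h1 : (fun i => ν.symm (σ i)) = id := by
    refine hm.range_inj strictMono_id |>.1 ?_
    have := (σ.trans ν.symm).surjective.range_eq
    simpa [Function.comp_def] using this
  ext i
  have := congrFun h1 i
  rw [id, symm_apply_eq] at this
  rw [this]

/-- Below `ν` in the weak order, every `σ ≠ ν` has a step upwards that stays below `ν`. -/
theorem exists_up_of_le {σ ν : Perm (Fin n)} (h : Le σ ν) (hne : σ ≠ ν) :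
    ∃ τ, Up σ τ ∧ Le τ ν := by
  by_contra! hcon
  refine hne (eq_of_forall_adjacent fun i j hij => ?_)
  have hne : σ i ≠ σ j := by
    simp only [ne_eq, EmbeddingLike.apply_eq_iff_eq]
    rintro rfl
    omega
  rcases lt_or_gt_of_ne hne with hlt | hlt
  · rw [← not_inv hlt]
    refine fun hinv => hcon _ ⟨i, j, hij, hlt, rfl⟩ fun a b hab => ?_
    rcases (inv_mul_swap hij hlt a b).1 hab with h1 | ⟨rfl, rfl⟩
    · exact h _ _ h1
    · exact hinv
  · refine (h (σ j) (σ i) ⟨hlt, ?_⟩).2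
    rw [symm_apply_apply, symm_apply_apply]
    exact Fin.lt_def.2 (by omega)

/-- The finite set of inversions. -/
noncomputable def invFinset (σ : Perm (Fin n)) : Finset (Fin n × Fin n) := by
  classical exact Finset.univ.filter fun x => Inv σ x.1 x.2

theorem mem_invFinset {σ : Perm (Fin n)} {x : Fin n × Fin n} :
    x ∈ invFinset σ ↔ Inv σ x.1 x.2 := by
  simp [invFinset]

theorem Up.card_lt {σ ν : Perm (Fin n)} (h : Up σ ν) :
    (invFinset σ).card < (invFinset ν).card := by
  refine Finset.card_lt_card (Finset.ssubset_iff_of_subset ?_ |>.2 ?_)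
  · exact fun x hx => mem_invFinset.2 (h.le _ _ (mem_invFinset.1 hx))
  · obtain ⟨i, j, hij, hσ, rfl⟩ := h
    refine ⟨(σ i, σ j), mem_invFinset.2 ((inv_mul_swap hij hσ _ _).2 (.inr ⟨rfl, rfl⟩)), ?_⟩
    rw [mem_invFinset]
    simp only [Inv, symm_apply_apply, Fin.lt_def]
    omega

theorem card_invFinset_le (σ : Perm (Fin n)) :
    (invFinset σ).card ≤ Fintype.card (Fin n × Fin n) :=
  Finset.card_le_univ _

theorem le_iff_reflTransGen_up {σ ν : Perm (Fin n)} :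
    Le σ ν ↔ Relation.ReflTransGen Up σ ν := by
  constructor
  · intro h
    induction hk : Fintype.card (Fin n × Fin n) - (invFinset σ).card using
      Nat.strong_induction_on generalizing σ with
    | _ k ih =>
      by_cases hne : σ = ν
      · rw [hne]
      · obtain ⟨τ, h1, h2⟩ := exists_up_of_le h hne
        refine .head h1 (ih _ ?_ h2 rfl)
        have := h1.card_lt
        have := card_invFinset_le τ
        omega
  · intro h
    induction h with
    | refl => exact .refl _
    | tail _ h ih => exact ih.trans h.le

theorem Le.antisymm {σ ν : Perm (Fin n)} (h : Le σ ν) (h' : Le ν σ) : σ = ν := by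
  by_contra hne
  obtain ⟨τ, h1, h2⟩ := exists_up_of_le h hne
  have h3 := h1.card_lt
  have h4 : (invFinset τ).card ≤ (invFinset σ).card := Finset.card_le_card fun x hx =>
    mem_invFinset.2 (h2.trans h' _ _ (mem_invFinset.1 hx))
  omega

/-- A transitive and cotransitive set of pairs `a < b` is the inversion set of a permutation:
reversing the natural order exactly on these pairs gives a linear order of the letters. -/
theorem exists_inv_iff {r : Fin n → Fin n → Prop} (hlt : ∀ {a b}, r a b → a < b)
    (htrans : ∀ {a b c}, r a b → r b c → r a c)
    (hcotrans : ∀ {a b c}, r a c → a < b → b < c → r a b ∨ r b c) :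
    ∃ σ : Perm (Fin n), ∀ a b, Inv σ a b ↔ r a b := by
  classical
  let s : Fin n → Fin n → Prop := fun x y => (x < y ∧ ¬ r x y) ∨ r y x
  have s_irrefl : ∀ x, ¬ s x x := by
    rintro x (h | h)
    · exact lt_irrefl _ h.1
    · exact lt_irrefl _ (hlt h)
  have s_total : ∀ x y, x ≠ y → s x y ∨ s y x := by
    intro x y hxy
    rcases lt_or_gt_of_ne hxy with h | h
    · by_cases hr : r x y
      · exact .inr (.inr hr)
      · exact .inl (.inl ⟨h, hr⟩)
    · by_cases hr : r y x
      · exact .inl (.inr hr)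
      · exact .inr (.inl ⟨h, hr⟩)
  have s_trans : ∀ x y z, s x y → s y z → s x z := by
    rintro x y z (⟨h1, h2⟩ | h1) (⟨h3, h4⟩ | h3)
    · exact .inl ⟨h1.trans h3, fun h => (hcotrans h h1 h3).elim h2 h4⟩
    · rcases lt_trichotomy x z with h | rfl | h
      · exact .inl ⟨h, fun h5 => h2 (htrans h5 h3)⟩
      · exact absurd h3 h2
      · exact .inr ((hcotrans h3 h h1).resolve_right h2)
    · rcases lt_trichotomy x z with h | rfl | h
      · exact .inl ⟨h, fun h5 => h4 (htrans h1 h5)⟩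
      · exact absurd h1 h4
      · exact .inr ((hcotrans h1 h3 h).resolve_left h4)
    · exact .inr (htrans h3 h1)
  let f : Fin n → Fin n := fun x => ⟨(Finset.univ.filter fun y => s y x).card, by
    have : (Finset.univ.filter fun y => s y x) ⊂ Finset.univ :=
      Finset.ssubset_univ_iff.2 fun h => s_irrefl x (by
        have := Finset.mem_univ x
        rw [← h] at this
        simpa using this)
    simpa using Finset.card_lt_card this⟩
  have f_lt : ∀ x y, s x y → f x < f y := by
    intro x y h
    change (Finset.univ.filter fun z => s z x).card < (Finset.univ.filter fun z => s z y).card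
    refine Finset.card_lt_card (Finset.ssubset_iff_of_subset ?_ |>.2 ⟨x, ?_, ?_⟩)
    · intro z hz
      simp only [Finset.mem_filter, Finset.mem_univ, true_and] at hz ⊢
      exact s_trans _ _ _ hz h
    · simpa using h
    · simpa using s_irrefl x
  have f_inj : Function.Injective f := by
    intro x y hxy
    by_contra hne
    rcases s_total x y hne with h | h
    · exact (f_lt _ _ h).ne hxy
    · exact (f_lt _ _ h).ne' hxy
  refine ⟨(Equiv.ofBijective f (Finite.injective_iff_bijective.1 f_inj)).symm, fun a b => ?_⟩
  simp only [Inv, symm_symm, ofBijective_apply]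
  constructor
  · rintro ⟨h1, h2⟩
    by_contra h3
    exact lt_asymm h2 (f_lt _ _ (.inl ⟨h1, h3⟩))
  · exact fun h => ⟨hlt h, f_lt _ _ (.inr h)⟩

theorem lt_of_transGen {r : Fin n → Fin n → Prop} (hlt : ∀ {a b}, r a b → a < b) {a b : Fin n}
    (h : Relation.TransGen r a b) : a < b := by
  induction h with
  | single h => exact hlt h
  | tail _ h ih => exact ih.trans (hlt h)

/-- The transitive closure of a cotransitive set of pairs is an inversion set: if `b` lies
strictly between the ends of a chain, then it lies on the chain or in the gap of one link. -/
theorem exists_inv_iff_transGen {r : Fin n → Fin n → Prop} (hlt : ∀ {a b}, r a b → a < b)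
    (hcotrans : ∀ {a b c}, r a c → a < b → b < c → r a b ∨ r b c) :
    ∃ σ : Perm (Fin n), ∀ a b, Inv σ a b ↔ Relation.TransGen r a b := by
  refine exists_inv_iff (lt_of_transGen hlt) .trans ?_
  intro a b c h hab hbc
  induction h with
  | single h => exact (hcotrans h hab hbc).imp .single .single
  | @tail d e hd hde ih =>
    rcases lt_trichotomy b d with h | rfl | h
    · exact (ih h).imp_right fun h => h.tail hde
    · exact .inl hd
    · exact (hcotrans hde h hbc).imp hd.tail .single

theorem exists_sup (σ ν : Perm (Fin n)) :
    ∃ τ : Perm (Fin n), ∀ a b, Inv τ a b ↔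
      Relation.TransGen (fun a b => Inv σ a b ∨ Inv ν a b) a b := by
  refine exists_inv_iff_transGen (fun h => h.elim (·.1) (·.1)) ?_
  rintro a b c (h | h) hab hbc
  · exact (h.cotrans hab hbc).imp .inl .inl
  · exact (h.cotrans hab hbc).imp .inr .inr

/-- The join of two permutations in the weak order. -/
noncomputable def sup (σ ν : Perm (Fin n)) : Perm (Fin n) := (exists_sup σ ν).choose

theorem inv_sup (σ ν : Perm (Fin n)) (a b : Fin n) :
    Inv (sup σ ν) a b ↔ Relation.TransGen (fun a b => Inv σ a b ∨ Inv ν a b) a b :=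
  (exists_sup σ ν).choose_spec a b

theorem le_sup_left (σ ν : Perm (Fin n)) : Le σ (sup σ ν) :=
  fun a b h => (inv_sup σ ν a b).2 (.single (.inl h))

theorem le_sup_right (σ ν : Perm (Fin n)) : Le ν (sup σ ν) :=
  fun a b h => (inv_sup σ ν a b).2 (.single (.inr h))

theorem sup_le {σ ν τ : Perm (Fin n)} (h : Le σ τ) (h' : Le ν τ) : Le (sup σ ν) τ := by
  intro a b hab
  rw [inv_sup] at hab
  induction hab with
  | single h1 => exact h1.elim (h _ _) (h' _ _)
  | tail _ h1 ih => exact ih.trans (h1.elim (h _ _) (h' _ _))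

/-- The complement of a permutation: every letter `a` is replaced by `n + 1 - a`. -/
def compl (σ : Perm (Fin n)) : Perm (Fin n) := Fin.revPerm * σ

@[simp]
theorem compl_apply (σ : Perm (Fin n)) (i : Fin n) : compl σ i = (σ i).rev := by
  simp [compl]

@[simp]
theorem compl_symm_apply (σ : Perm (Fin n)) (a : Fin n) :
    (compl σ).symm a = σ.symm a.rev := by
  rw [symm_apply_eq]
  simp

@[simp]
theorem compl_compl (σ : Perm (Fin n)) : compl (compl σ) = σ := by
  ext i
  simp

theorem compl_le_compl {σ ν : Perm (Fin n)} (h : Le σ ν) : Le (compl ν) (compl σ) := by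
  rintro a b ⟨hab, h1⟩
  refine ⟨hab, ?_⟩
  simp only [compl_symm_apply] at h1 ⊢
  have h2 : b.rev < a.rev := Fin.rev_lt_rev.2 hab
  rw [← not_inv h2]
  exact fun h3 => lt_asymm h1 (h _ _ h3).2

/-- The meet of two permutations in the weak order. -/
noncomputable def inf (σ ν : Perm (Fin n)) : Perm (Fin n) := compl (sup (compl σ) (compl ν))

theorem inf_le_left (σ ν : Perm (Fin n)) : Le (inf σ ν) σ := by
  simpa [inf] using compl_le_compl (le_sup_left (compl σ) (compl ν))

theorem inf_le_right (σ ν : Perm (Fin n)) : Le (inf σ ν) ν := by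
  simpa [inf] using compl_le_compl (le_sup_right (compl σ) (compl ν))

theorem le_inf {σ ν τ : Perm (Fin n)} (h : Le τ σ) (h' : Le τ ν) : Le τ (inf σ ν) := by
  simpa [inf] using compl_le_compl (sup_le (compl_le_compl h) (compl_le_compl h'))

/-! ### Baxter steps and the order of the Baxter classes -/

/-- The letter `a` is the first one in `σ` among the letters of the interval between `a` and `c`
(where `a ≤ c` or `c ≤ a`). -/
def First (σ : Perm (Fin n)) (a c : Fin n) : Prop :=
  ∀ b, min a c ≤ b → b ≤ max a c → σ.symm a ≤ σ.symm b

/-- The letter `a` is the last one in `σ` among the letters of the interval between `a` and `c`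
(where `a ≤ c` or `c ≤ a`). -/
def Last (σ : Perm (Fin n)) (a c : Fin n) : Prop :=
  ∀ b, min a c ≤ b → b ≤ max a c → σ.symm b ≤ σ.symm a

theorem first_iff_of_lt {σ : Perm (Fin n)} {a c : Fin n} (h : a < c) :
    First σ a c ↔ ∀ b, a < b → b ≤ c → ¬ Inv σ a b := by
  simp only [First, min_eq_left h.le, max_eq_right h.le]
  constructor
  · exact fun H b h1 h2 h3 => (H b h1.le h2).not_gt h3.2
  · intro H b h1 h2
    rcases h1.eq_or_lt with rfl | h1
    · exact le_rfl
    · exact ((not_inv h1).1 (H b h1 h2)).le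

theorem last_iff_of_gt {σ : Perm (Fin n)} {a c : Fin n} (h : a < c) :
    Last σ c a ↔ ∀ b, a ≤ b → b < c → ¬ Inv σ b c := by
  simp only [Last, min_eq_right h.le, max_eq_left h.le]
  constructor
  · exact fun H b h1 h2 h3 => (H b h1 h2.le).not_gt h3.2
  · intro H b h1 h2
    rcases h2.eq_or_lt with rfl | h2
    · exact le_rfl
    · exact ((not_inv h2).1 (H b h1 h2)).le

/-- A Baxter step upwards in the weak order: a swap of two consecutive letters in increasing order
such that some letter with a value between them precedes them, and another one follows them. -/
def BaxterStep (σ ν : Perm (Fin n)) : Prop :=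
  ∃ i j k l : Fin n, (i : ℕ) + 1 = j ∧ σ i < σ j ∧ ν = σ * swap i j ∧ k < i ∧ j < l ∧
    σ i < σ k ∧ σ k < σ j ∧ σ i < σ l ∧ σ l < σ j

/-- The equivalence relation generated by the Baxter steps. -/
def BaxterEquiv : Perm (Fin n) → Perm (Fin n) → Prop := Relation.EqvGen BaxterStep

theorem BaxterEquiv.symm {σ ν : Perm (Fin n)} (h : BaxterEquiv σ ν) : BaxterEquiv ν σ :=
  Relation.EqvGen.symm _ _ h

theorem BaxterEquiv.trans {σ ν τ : Perm (Fin n)} (h : BaxterEquiv σ ν) (h' : BaxterEquiv ν τ) :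
    BaxterEquiv σ τ :=
  Relation.EqvGen.trans _ _ _ h h'

theorem BaxterStep.up {σ ν : Perm (Fin n)} : BaxterStep σ ν → Up σ ν := by
  rintro ⟨i, j, k, l, h1, h2, h3, -⟩
  exact ⟨i, j, h1, h2, h3⟩

theorem BaxterStep.compl {σ ν : Perm (Fin n)} (h : BaxterStep σ ν) :
    BaxterStep (compl ν) (compl σ) := by
  obtain ⟨i, j, k, l, hij, h1, rfl, hk, hl, h2, h3, h4, h5⟩ := h
  have hij' : i < j := by omega
  refine ⟨i, j, k, l, hij, ?_, ?_, hk, hl, ?_⟩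
  · simpa using h1
  · ext x
    simp
  · simp [swap_apply_of_ne_of_ne hk.ne (hk.trans hij').ne,
      swap_apply_of_ne_of_ne (hij'.trans hl).ne' hl.ne', *]

theorem BaxterEquiv.compl {σ ν : Perm (Fin n)} (h : BaxterEquiv σ ν) :
    BaxterEquiv (compl σ) (compl ν) := by
  induction h with
  | rel _ _ h => exact Relation.EqvGen.symm _ _ (.rel _ _ h.compl)
  | refl => exact .refl _
  | symm _ _ _ ih => exact ih.symm
  | trans _ _ _ _ _ ih ih' => exact ih.trans ih'

/-- A Baxter step only changes the relative order of two letters that have witnesses on both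
sides. A first or last letter of an interval is not affected, since one of the witnesses already
prevents both swapped letters from being that letter. -/
theorem BaxterStep.first_last {σ ν : Perm (Fin n)} (h : BaxterStep σ ν) (a c : Fin n) :
    (First σ a c ↔ First ν a c) ∧ (Last σ a c ↔ Last ν a c) := by
  obtain ⟨i, j, k, l, hij, h1, rfl, hk, hl, h2, h3, h4, h5⟩ := h
  have hsymm : ∀ x, (σ * swap i j).symm x = swap i j (σ.symm x) := by
    intro x
    rw [Equiv.symm_apply_eq]
    simp
  -- the relative order of all the other pairs of letters is unchanged
  have hle : ∀ x y, ¬ (x = σ i ∧ y = σ j) → ¬ (x = σ j ∧ y = σ i) →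
      (σ.symm x ≤ σ.symm y ↔ (σ * swap i j).symm x ≤ (σ * swap i j).symm y) := by
    intro x y
    obtain ⟨p, rfl⟩ := σ.surjective x
    obtain ⟨q, rfl⟩ := σ.surjective y
    rw [hsymm, hsymm]
    simp only [symm_apply_apply, EmbeddingLike.apply_eq_iff_eq, swap_apply_def]
    intro h h'
    simp only [Fin.ext_iff] at h h'
    split_ifs <;> simp only [Fin.ext_iff] at * <;> simp only [Fin.le_def] <;> omega
  have hk' : swap i j k = k := swap_apply_of_ne_of_ne hk.ne (by omega)
  have hl' : swap i j l = l := swap_apply_of_ne_of_ne (by omega) hl.ne'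
  by_cases hcase : (a = σ i ∨ a = σ j) ∧ (min a c ≤ σ i ∧ σ j ≤ max a c)
  · obtain ⟨ha, hc1, hc2⟩ := hcase
    refine ⟨iff_of_false (fun H => ?_) (fun H => ?_), iff_of_false (fun H => ?_) (fun H => ?_)⟩
    · have := H (σ k) (hc1.trans h2.le) (h3.le.trans hc2)
      rcases ha with rfl | rfl <;> simp only [symm_apply_apply] at this <;> omega
    · have := H (σ k) (hc1.trans h2.le) (h3.le.trans hc2)
      rcases ha with rfl | rfl <;> simp only [hsymm, symm_apply_apply, hk', swap_apply_left,
        swap_apply_right] at this <;> omega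
    · have := H (σ l) (hc1.trans h4.le) (h5.le.trans hc2)
      rcases ha with rfl | rfl <;> simp only [symm_apply_apply] at this <;> omega
    · have := H (σ l) (hc1.trans h4.le) (h5.le.trans hc2)
      rcases ha with rfl | rfl <;> simp only [hsymm, symm_apply_apply, hl', swap_apply_left,
        swap_apply_right] at this <;> omega
  · have key : ∀ b, min a c ≤ b → b ≤ max a c →
        ¬ (a = σ i ∧ b = σ j) ∧ ¬ (a = σ j ∧ b = σ i) := by
      refine fun b hb hb' => ⟨?_, ?_⟩
      · rintro ⟨rfl, rfl⟩
        exact hcase ⟨.inl rfl, min_le_left _ _, hb'⟩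
      · rintro ⟨rfl, rfl⟩
        exact hcase ⟨.inr rfl, hb, le_max_left _ _⟩
    constructor
    · refine forall₃_congr fun b hb hb' => ?_
      exact hle _ _ (key b hb hb').1 (key b hb hb').2
    · refine forall₃_congr fun b hb hb' => ?_
      exact hle _ _ (fun h => (key b hb hb').2 h.symm) (fun h => (key b hb hb').1 h.symm)

theorem BaxterEquiv.first_last {σ ν : Perm (Fin n)} (h : BaxterEquiv σ ν) (a c : Fin n) :
    (First σ a c ↔ First ν a c) ∧ (Last σ a c ↔ Last ν a c) := by
  induction h with
  | rel _ _ h => exact h.first_last a c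
  | refl => exact ⟨.rfl, .rfl⟩
  | symm _ _ _ ih => exact ⟨ih.1.symm, ih.2.symm⟩
  | trans _ _ _ _ _ ih ih' => exact ⟨ih.1.trans ih'.1, ih.2.trans ih'.2⟩

/-- The order of the Baxter classes, read off from intervals of letters: every interval whose
smallest letter comes first in `τ` or whose largest letter comes last in `τ` has the same property
in `σ`. -/
def DataLe (σ τ : Perm (Fin n)) : Prop :=
  ∀ a c, a < c → (First τ a c → First σ a c) ∧ (Last τ c a → Last σ c a)

theorem DataLe.trans {σ τ ρ : Perm (Fin n)} (h : DataLe σ τ) (h' : DataLe τ ρ) : DataLe σ ρ :=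
  fun a c hac => ⟨(h a c hac).1 ∘ (h' a c hac).1, (h a c hac).2 ∘ (h' a c hac).2⟩

theorem Le.dataLe {σ τ : Perm (Fin n)} (h : Le σ τ) : DataLe σ τ := by
  intro a c hac
  rw [first_iff_of_lt hac, first_iff_of_lt hac, last_iff_of_gt hac, last_iff_of_gt hac]
  exact ⟨fun H b h1 h2 h3 => H b h1 h2 (h _ _ h3), fun H b h1 h2 h3 => H b h1 h2 (h _ _ h3)⟩

theorem BaxterEquiv.dataLe {σ τ : Perm (Fin n)} (h : BaxterEquiv σ τ) : DataLe σ τ :=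
  fun a c _ => ⟨(h.first_last a c).1.2, (h.first_last c a).2.2⟩

/-- If no Baxter step leads upwards from `τ`, then every permutation below `τ` in the order of the
classes is below `τ` itself. For consecutive letters `a < d` of `τ`, no witness precedes them, and
`a` is the first letter of the interval from `a` to `d`, or no witness follows them, and `d` is the
last one. If `p < q` stand in this order in `τ` and no letter with a value between them stands
between them, then some consecutive letters `a < d` between them satisfy `a ≤ p` and `q ≤ d`, and
`a = p` in the first case, `d = q` in the second one. -/
theorem le_of_dataLe_of_forall_not {σ τ : Perm (Fin n)} (hτ : ∀ ν, ¬ BaxterStep τ ν)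
    (h : DataLe σ τ) : Le σ τ := by
  have main : ∀ (m : ℕ) (P Q : Fin n), (Q : ℕ) - P = m → P < Q → τ P < τ Q →
      σ.symm (τ P) < σ.symm (τ Q) := by
    intro m
    induction m using Nat.strong_induction_on with
    | _ m ih =>
      intro P Q hm hPQ hpq
      by_cases hr : ∃ R, P < R ∧ R < Q ∧ τ P < τ R ∧ τ R < τ Q
      · obtain ⟨R, h1, h2, h3, h4⟩ := hr
        exact (ih _ (by omega) P R rfl h1 h3).trans (ih _ (by omega) R Q rfl h2 h4)
      push Not at hr
      -- the last position before `Q` with a letter at most `τ P`; the next one starts an ascent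
      classical
      obtain ⟨i, hi, himax⟩ := (Finset.univ.filter fun i => P ≤ i ∧ i < Q ∧ τ i ≤ τ P).exists_max_image
        id ⟨P, by simpa using hPQ⟩
      simp only [Finset.mem_filter, Finset.mem_univ, true_and, id] at hi himax
      obtain ⟨hPi, hiQ, hip⟩ := hi
      obtain ⟨j, hij⟩ : ∃ j : Fin n, (i : ℕ) + 1 = j := ⟨⟨i + 1, by omega⟩, rfl⟩
      have hjp : τ P < τ j := by
        by_contra! hcon
        have hjQ : j < Q := by
          refine lt_of_le_of_ne (Fin.le_def.2 (by omega)) ?_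
          rintro hj
          rw [hj] at hcon
          exact hcon.not_gt hpq
        have := himax j ⟨by omega, hjQ, hcon⟩
        omega
      have hjq : τ Q ≤ τ j := by
        rcases eq_or_ne j Q with hj | hj
        · rw [hj]
        · exact hr j (by omega) (by omega) hjp
      have hac : τ i < τ j := hip.trans_lt hjp
      by_cases hk : ∃ k, k < i ∧ τ i < τ k ∧ τ k < τ j
      · -- a witness precedes, so none follows
        obtain ⟨k, hk1, hk2, hk3⟩ := hk
        have hno : ∀ l, τ i < τ l → τ l < τ j → l < j := by
          intro l h1 h2
          by_contra! h3
          rcases h3.eq_or_lt with h3 | h3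
          · exact h2.ne (by rw [h3])
          · exact hτ _ ⟨i, j, k, l, hij, hac, rfl, hk1, h3, hk2, hk3, h1, h2⟩
        have hQ : Q = j := by
          by_contra hne
          have hlt : τ Q < τ j := lt_of_le_of_ne hjq (by simpa using hne)
          have := hno Q (hip.trans_lt hpq) hlt
          omega
        subst hQ
        have hlast : Last τ (τ Q) (τ i) := by
          intro b h1 h2
          rw [min_eq_right hac.le] at h1
          rw [max_eq_left hac.le] at h2
          obtain ⟨l, rfl⟩ := τ.surjective b
          simp only [symm_apply_apply]
          rcases h1.eq_or_lt with h1 | h1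
          · rw [← τ.injective h1]; omega
          rcases h2.eq_or_lt with h2 | h2
          · rw [τ.injective h2]
          · exact (hno l h1 h2).le
        exact (not_inv hpq).1 ((last_iff_of_gt hac).1 ((h _ _ hac).2 hlast) _ hip hpq)
      · -- no witness precedes
        push Not at hk
        have hP : P = i := by
          by_contra hne
          have hlt : τ i < τ P := lt_of_le_of_ne hip (by simpa using Ne.symm hne)
          exact (hk P (lt_of_le_of_ne hPi hne) hlt).not_gt hjp
        subst hP
        have hfirst : First τ (τ P) (τ j) := by
          intro b h1 h2
          rw [min_eq_left hac.le] at h1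
          rw [max_eq_right hac.le] at h2
          obtain ⟨l, rfl⟩ := τ.surjective b
          simp only [symm_apply_apply]
          rcases h1.eq_or_lt with h1 | h1
          · rw [← τ.injective h1]
          rcases h2.eq_or_lt with h2 | h2
          · rw [τ.injective h2]; omega
          · by_contra! h3
            exact (hk l h3 h1).not_gt h2
        exact (not_inv hpq).1 ((first_iff_of_lt hac).1 ((h _ _ hac).1 hfirst) _ hpq hjq)
  intro a b hab
  by_contra hcon
  rw [not_inv hab.1] at hcon
  have := main _ (τ.symm a) (τ.symm b) rfl hcon (by simpa using hab.1)
  simp only [apply_symm_apply] at this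
  exact lt_asymm this hab.2

theorem exists_maximal_baxterEquiv (σ : Perm (Fin n)) :
    ∃ τ, BaxterEquiv σ τ ∧ ∀ ν, ¬ BaxterStep τ ν := by
  classical
  obtain ⟨τ, h1, h2⟩ := (Finset.univ.filter fun τ => BaxterEquiv σ τ).exists_max_image
    (fun τ => (invFinset τ).card) ⟨σ,
      Finset.mem_filter.2 ⟨Finset.mem_univ _, Relation.EqvGen.refl σ⟩⟩
  simp only [Finset.mem_filter, Finset.mem_univ, true_and] at h1 h2
  exact ⟨τ, h1, fun ν h => (h2 ν (h1.trans (.rel _ _ h))).not_gt h.up.card_lt⟩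

theorem DataLe.exists_le {σ τ : Perm (Fin n)} (h : DataLe σ τ) :
    ∃ τ', BaxterEquiv τ' τ ∧ Le σ τ' := by
  obtain ⟨τ', h1, h2⟩ := exists_maximal_baxterEquiv τ
  exact ⟨τ', h1.symm, le_of_dataLe_of_forall_not h2 (h.trans h1.dataLe)⟩

theorem DataLe.antisymm {σ τ : Perm (Fin n)} (h : DataLe σ τ) (h' : DataLe τ σ) :
    BaxterEquiv σ τ := by
  obtain ⟨σ', h1, h2⟩ := exists_maximal_baxterEquiv σ
  obtain ⟨τ', h3, h4⟩ := exists_maximal_baxterEquiv τ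
  have h5 : σ' = τ' :=
    (le_of_dataLe_of_forall_not h4 ((h1.symm.dataLe.trans h).trans h3.dataLe)).antisymm
      (le_of_dataLe_of_forall_not h2 ((h3.symm.dataLe.trans h').trans h1.dataLe))
  exact h1.trans (h5 ▸ h3.symm)

theorem DataLe.compl {σ τ : Perm (Fin n)} (h : DataLe σ τ) : DataLe (compl τ) (compl σ) := by
  obtain ⟨τ', h1, h2⟩ := h.exists_le
  exact h1.symm.compl.dataLe.trans (compl_le_compl h2).dataLe

theorem dataLe_sup {σ ν τ : Perm (Fin n)} (h : DataLe σ τ) (h' : DataLe ν τ) :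
    DataLe (sup σ ν) τ := by
  obtain ⟨ρ, h1, h2⟩ := exists_maximal_baxterEquiv τ
  exact (sup_le (le_of_dataLe_of_forall_not h2 (h.trans h1.dataLe))
    (le_of_dataLe_of_forall_not h2 (h'.trans h1.dataLe))).dataLe.trans h1.symm.dataLe

theorem dataLe_inf {σ ν τ : Perm (Fin n)} (h : DataLe τ σ) (h' : DataLe τ ν) :
    DataLe τ (inf σ ν) := by
  simpa [inf] using (dataLe_sup h.compl h'.compl).compl

theorem BaxterEquiv.sup {σ σ' ν ν' : Perm (Fin n)} (h : BaxterEquiv σ σ')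
    (h' : BaxterEquiv ν ν') : BaxterEquiv (sup σ ν) (sup σ' ν') :=
  (dataLe_sup (h.dataLe.trans (le_sup_left _ _).dataLe)
    (h'.dataLe.trans (le_sup_right _ _).dataLe)).antisymm
  (dataLe_sup (h.symm.dataLe.trans (le_sup_left _ _).dataLe)
    (h'.symm.dataLe.trans (le_sup_right _ _).dataLe))

theorem BaxterEquiv.inf {σ σ' ν ν' : Perm (Fin n)} (h : BaxterEquiv σ σ')
    (h' : BaxterEquiv ν ν') : BaxterEquiv (inf σ ν) (inf σ' ν') :=
  (h.compl.sup h'.compl).compl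

/-! ### Permutations as words -/

theorem length_word (σ : Perm (Fin n)) : (word σ).length = n := by
  simp [word]

theorem word_getElem? (σ : Perm (Fin n)) (i : Fin n) :
    (word σ)[(i : ℕ)]? = some ((σ i : ℕ) + 1) := by
  simp [word]

theorem word_injective : Function.Injective (word : Perm (Fin n) → List ℕ) := by
  intro σ ν h
  ext i
  have := word_getElem? σ i
  rw [h, word_getElem?] at this
  simpa using this.symm

/-- A swap of two consecutive letters in a word of a permutation is a swap of the entries in two
consecutive positions. -/
theorem word_mul_swap {σ : Perm (Fin n)} {u v : List ℕ} {x y : ℕ}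
    (h : word σ = u ++ [x, y] ++ v) : ∃ i j : Fin n, (i : ℕ) + 1 = j ∧ (i : ℕ) = u.length ∧
      (σ i : ℕ) + 1 = x ∧ (σ j : ℕ) + 1 = y ∧ word (σ * swap i j) = u ++ [y, x] ++ v := by
  have hlen : n = u.length + 2 + v.length := by
    rw [← length_word σ, h]
    simp
    omega
  have hget : ∀ k : Fin n, some ((σ k : ℕ) + 1) = (u ++ [x, y] ++ v)[(k : ℕ)]? := by
    intro k
    rw [← h, word_getElem?]
  let i : Fin n := ⟨u.length, by omega⟩
  let j : Fin n := ⟨u.length + 1, by omega⟩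
  refine ⟨i, j, rfl, rfl, ?_, ?_, ?_⟩
  · simpa [i] using hget i
  · simpa [j] using hget j
  · apply List.ext_getElem?
    intro m
    by_cases hm : m < n
    · rw [word_getElem? _ ⟨m, hm⟩, Perm.mul_apply, hget, swap_apply_def]
      simp only [i, j, Fin.ext_iff]
      split_ifs with h1 h2
      · simp [h1]
      · simp [h2]
      · rw [List.getElem?_append, List.getElem?_append, List.getElem?_append, List.getElem?_append]
        simp only [List.length_append, List.length_cons, List.length_nil]
        split_ifs
        · rfl
        · omega
        · rfl
    · rw [List.getElem?_eq_none (by rw [length_word]; omega),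
        List.getElem?_eq_none (by simp; omega)]

theorem word_eq_append {σ : Perm (Fin n)} {i j : Fin n} (hij : (i : ℕ) + 1 = j) :
    word σ = (word σ).take i ++ [(σ i : ℕ) + 1, (σ j : ℕ) + 1] ++ (word σ).drop (i + 2) := by
  apply List.ext_getElem?
  intro m
  have hlen := length_word σ
  rw [List.getElem?_append, List.getElem?_append]
  simp only [List.length_append, List.length_cons, List.length_nil, List.length_take, hlen,
    min_eq_left i.2.le]
  split_ifs with h1 h2
  · simp [h2]
  · obtain h3 | h3 : m = i ∨ m = j := by omega
    · rw [h3, word_getElem?]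
      simp
    · rw [h3, word_getElem?]
      simp [← hij]
  · rw [List.getElem?_drop]
    congr 1
    omega

theorem word_mul_swap_eq_append {σ : Perm (Fin n)} {i j : Fin n} (hij : (i : ℕ) + 1 = j) :
    word (σ * swap i j) =
      (word σ).take i ++ [(σ j : ℕ) + 1, (σ i : ℕ) + 1] ++ (word σ).drop (i + 2) := by
  obtain ⟨i', j', hij', hi', -, -, h⟩ := word_mul_swap (word_eq_append (σ := σ) hij)
  simp only [List.length_take, length_word, min_eq_left i.2.le] at hi'
  obtain rfl : i' = i := Fin.ext hi'
  obtain rfl : j' = j := Fin.ext (by omega)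
  exact h

theorem permCover_iff_up {σ ν : Perm (Fin n)} : PermCover σ ν ↔ Up σ ν := by
  constructor
  · rintro ⟨u, v, a, b, hab, h1, h2⟩
    obtain ⟨i, j, hij, -, rfl, rfl, h3⟩ := word_mul_swap h1
    exact ⟨i, j, hij, by simpa using hab, word_injective (h2.trans h3.symm)⟩
  · rintro ⟨i, j, hij, hσ, rfl⟩
    exact ⟨_, _, _, _, by simpa using hσ, word_eq_append hij, word_mul_swap_eq_append hij⟩

theorem permLE_iff_le {σ ν : Perm (Fin n)} : PermLE σ ν ↔ Le σ ν := by
  rw [le_iff_reflTransGen_up, PermLE]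
  have : (PermCover : Perm (Fin n) → _ → Prop) = Up := by
    ext σ ν
    exact permCover_iff_up
  rw [this]

theorem exists_lt_of_mem {σ : Perm (Fin n)} {u v : List ℕ} (h : word σ = u ++ v) {x : ℕ}
    (hx : x ∈ u) : ∃ k : Fin n, (k : ℕ) < u.length ∧ (σ k : ℕ) + 1 = x := by
  obtain ⟨m, hm, rfl⟩ := List.getElem_of_mem hx
  have hlen := length_word σ
  rw [h, List.length_append] at hlen
  refine ⟨⟨m, by omega⟩, hm, ?_⟩
  have := word_getElem? σ ⟨m, by omega⟩
  rw [h, List.getElem?_append_left hm, List.getElem?_eq_getElem hm] at this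
  simpa using this.symm

theorem exists_ge_of_mem {σ : Perm (Fin n)} {u v : List ℕ} (h : word σ = u ++ v) {x : ℕ}
    (hx : x ∈ v) : ∃ k : Fin n, u.length ≤ (k : ℕ) ∧ (σ k : ℕ) + 1 = x := by
  obtain ⟨m, hm, rfl⟩ := List.getElem_of_mem hx
  have hlen := length_word σ
  rw [h, List.length_append] at hlen
  refine ⟨⟨u.length + m, by omega⟩, by simp, ?_⟩
  have := word_getElem? σ ⟨u.length + m, by omega⟩
  rw [h, List.getElem?_append_right (by simp)] at this
  simp only [add_tsub_cancel_left, List.getElem?_eq_getElem hm] at this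
  simpa using this.symm

/-- Both adjacency relations have the same form on the word of a permutation: two consecutive
letters `a` and `d` may be swapped if a letter `x` before them and a letter `y` after them have
weakly intermediate values. The intermediate values are then strict, as the letters of a
permutation are distinct. -/
theorem exists_baxterEquiv_of_word_eq {σ : Perm (Fin n)} {u v : List ℕ} {a d x y : ℕ}
    (h : word σ = u ++ [a, d] ++ v) (hx : x ∈ u) (hy : y ∈ v) (hax : a ≤ x) (hxd : x ≤ d)
    (hay : a ≤ y) (hyd : y ≤ d) (had : a < d) :
    ∃ ν : Perm (Fin n), word ν = u ++ [d, a] ++ v ∧ BaxterEquiv σ ν := by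
  obtain ⟨i, j, hij, hi, rfl, rfl, h'⟩ := word_mul_swap h
  obtain ⟨k, hk, rfl⟩ := exists_lt_of_mem (by rw [h, List.append_assoc]) hx
  obtain ⟨l, hl, rfl⟩ := exists_ge_of_mem h hy
  simp only [List.length_append, List.length_cons, List.length_nil] at hl
  have hne : ∀ p q : Fin n, (p : ℕ) ≠ q → (σ p : ℕ) ≠ σ q := by
    intro p q hpq heq
    exact hpq (congrArg _ (σ.injective (Fin.ext heq)))
  have h1 := hne k i (by omega)
  have h2 := hne k j (by omega)
  have h3 := hne l i (by omega)
  have h4 := hne l j (by omega)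
  exact ⟨_, h', .rel _ _ ⟨i, j, k, l, hij, by omega, rfl, by omega, by omega, by omega, by omega,
    by omega, by omega⟩⟩

theorem exists_baxterEquiv_of_word_eq' {σ : Perm (Fin n)} {u v : List ℕ} {a d x y : ℕ}
    (h : word σ = u ++ [d, a] ++ v) (hx : x ∈ u) (hy : y ∈ v) (hax : a ≤ x) (hxd : x ≤ d)
    (hay : a ≤ y) (hyd : y ≤ d) (had : a < d) :
    ∃ ν : Perm (Fin n), word ν = u ++ [a, d] ++ v ∧ BaxterEquiv σ ν := by
  obtain ⟨i, j, hij, hi, hd, ha, h'⟩ := word_mul_swap h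
  obtain ⟨ν, h1, h2⟩ := exists_baxterEquiv_of_word_eq h' hx hy hax hxd hay hyd had
  rw [← h] at h1
  rw [word_injective h1] at h2
  exact ⟨_, h', h2.symm⟩

/-- A congruence between factors of words, seen from the words of permutations that contain these
factors, stays within the permutations. -/
theorem exists_baxterEquiv_of_rel {w w' : FreeMonoid ℕ} (h : ConGen.Rel Adj w w') :
    ∀ p q : List ℕ,
      (∀ σ : Perm (Fin n), word σ = p ++ w.toList ++ q →
        ∃ ν : Perm (Fin n), word ν = p ++ w'.toList ++ q ∧ BaxterEquiv σ ν) ∧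
      (∀ σ : Perm (Fin n), word σ = p ++ w'.toList ++ q →
        ∃ ν : Perm (Fin n), word ν = p ++ w.toList ++ q ∧ BaxterEquiv σ ν) := by
  induction h with
  | of w w' h =>
    intro p q
    cases h with
    | first u v a b c d hab hbc hcd =>
      constructor <;> intro σ hσ
      · obtain ⟨ν, h1, h2⟩ := exists_baxterEquiv_of_word_eq (σ := σ) (u := p ++ [c] ++ u)
          (v := v ++ [b] ++ q) (a := a) (d := d) (x := c) (y := b) (by simpa using hσ) (by simp)
          (by simp) (by omega) hcd hab (by omega) (by omega)
        exact ⟨ν, by simpa using h1, h2⟩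
      · obtain ⟨ν, h1, h2⟩ := exists_baxterEquiv_of_word_eq' (σ := σ) (u := p ++ [c] ++ u)
          (v := v ++ [b] ++ q) (a := a) (d := d) (x := c) (y := b) (by simpa using hσ) (by simp)
          (by simp) (by omega) hcd hab (by omega) (by omega)
        exact ⟨ν, by simpa using h1, h2⟩
    | second u v a b c d hab hbc hcd =>
      constructor <;> intro σ hσ
      · obtain ⟨ν, h1, h2⟩ := exists_baxterEquiv_of_word_eq' (σ := σ) (u := p ++ [b] ++ u)
          (v := v ++ [c] ++ q) (a := a) (d := d) (x := b) (y := c) (by simpa using hσ) (by simp)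
          (by simp) hab.le (by omega) (by omega) hcd.le (by omega)
        exact ⟨ν, by simpa using h1, h2⟩
      · obtain ⟨ν, h1, h2⟩ := exists_baxterEquiv_of_word_eq (σ := σ) (u := p ++ [b] ++ u)
          (v := v ++ [c] ++ q) (a := a) (d := d) (x := b) (y := c) (by simpa using hσ) (by simp)
          (by simp) hab.le (by omega) (by omega) hcd.le (by omega)
        exact ⟨ν, by simpa using h1, h2⟩
  | refl w => exact fun p q => ⟨fun σ h => ⟨σ, h, .refl _⟩, fun σ h => ⟨σ, h, .refl _⟩⟩
  | symm _ ih => exact fun p q => (ih p q).symm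
  | trans _ _ ih ih' =>
    intro p q
    constructor <;> intro σ h
    · obtain ⟨ν, h1, h2⟩ := (ih p q).1 σ h
      obtain ⟨τ, h3, h4⟩ := (ih' p q).1 ν h1
      exact ⟨τ, h3, h2.trans h4⟩
    · obtain ⟨ν, h1, h2⟩ := (ih' p q).2 σ h
      obtain ⟨τ, h3, h4⟩ := (ih p q).2 ν h1
      exact ⟨τ, h3, h2.trans h4⟩
  | @mul w x y z _ _ ih ih' =>
    intro p q
    constructor <;> intro σ h
    · obtain ⟨ν, h1, h2⟩ := (ih p (y.toList ++ q)).1 σ (by simpa using h)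
      obtain ⟨τ, h3, h4⟩ := (ih' (p ++ x.toList) q).1 ν (by simpa using h1)
      exact ⟨τ, by simpa using h3, h2.trans h4⟩
    · obtain ⟨ν, h1, h2⟩ := (ih p (z.toList ++ q)).2 σ (by simpa using h)
      obtain ⟨τ, h3, h4⟩ := (ih' (p ++ w.toList) q).2 ν (by simpa using h1)
      exact ⟨τ, by simpa using h3, h2.trans h4⟩

theorem mem_take_word {σ : Perm (Fin n)} {k : Fin n} {m : ℕ} (h : (k : ℕ) < m) :
    (σ k : ℕ) + 1 ∈ (word σ).take m := by
  rw [List.mem_iff_getElem?]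
  exact ⟨k, by rw [List.getElem?_take_of_lt h, word_getElem?]⟩

theorem mem_drop_word {σ : Perm (Fin n)} {k : Fin n} {m : ℕ} (h : m ≤ (k : ℕ)) :
    (σ k : ℕ) + 1 ∈ (word σ).drop m := by
  rw [List.mem_iff_getElem?]
  exact ⟨k - m, by rw [List.getElem?_drop, Nat.add_sub_cancel' h, word_getElem?]⟩

theorem BaxterStep.permEquiv {σ ν : Perm (Fin n)} (h : BaxterStep σ ν) : PermEquiv σ ν := by
  obtain ⟨i, j, k, l, hij, h1, rfl, hk, hl, h2, h3, h4, h5⟩ := h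
  have hw := word_eq_append (σ := σ) hij
  have hw' := word_mul_swap_eq_append (σ := σ) hij
  obtain ⟨p, u, hu⟩ := List.append_of_mem (mem_take_word (σ := σ) (k := k) (m := i) hk)
  obtain ⟨v, q, hv⟩ := List.append_of_mem
    (mem_drop_word (σ := σ) (k := l) (m := i + 2) (by omega))
  rw [hu, hv] at hw hw'
  have hne : (σ k : ℕ) ≠ σ l := by
    intro h
    have := σ.injective (Fin.ext h)
    omega
  rw [PermEquiv, hw, hw']
  -- the two witnesses are ordered in one of two ways, which selects the adjacency relation
  rcases lt_or_gt_of_ne hne with h | h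
  · have := con.mul (con.mul (con.refl (FreeMonoid.ofList p)) (con.symm (ConGen.Rel.of _ _
      (Adj.second u v (σ i + 1) (σ k + 1) (σ l + 1) (σ j + 1) (by omega) (by omega) (by omega)))))
      (con.refl (FreeMonoid.ofList q))
    simpa only [← FreeMonoid.ofList_append, List.append_assoc, List.cons_append,
      List.nil_append] using this
  · have := con.mul (con.mul (con.refl (FreeMonoid.ofList p)) (ConGen.Rel.of _ _
      (Adj.first u v (σ i + 1) (σ l + 1) (σ k + 1) (σ j + 1) (by omega) (by omega) (by omega))))
      (con.refl (FreeMonoid.ofList q))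
    simpa only [← FreeMonoid.ofList_append, List.append_assoc, List.cons_append,
      List.nil_append] using this

theorem permEquiv_iff_baxterEquiv {σ ν : Perm (Fin n)} : PermEquiv σ ν ↔ BaxterEquiv σ ν := by
  constructor
  · intro h
    obtain ⟨τ, h1, h2⟩ := (exists_baxterEquiv_of_rel (n := n) h [] []).1 σ (by simp)
    obtain rfl : τ = ν := word_injective (by simpa using h1)
    exact h2
  · intro h
    induction h with
    | rel _ _ h => exact h.permEquiv
    | refl => exact con.refl _
    | symm _ _ _ ih => exact con.symm ih
    | trans _ _ _ _ _ ih ih' => exact con.trans ih ih'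

/-! ### Binary search trees -/

/-- The binary search tree obtained by leaf insertion of the letters of a word from left to
right. -/
def leafTree (w : List ℕ) : BinaryTree ℕ := w.foldl (fun T a => leafInsert a T) .nil

theorem foldl_leafInsert_node (a : ℕ) (l r : BinaryTree ℕ) (w : List ℕ) :
    w.foldl (fun T x => leafInsert x T) (.node a l r) =
      .node a ((w.filter (· < a)).foldl (fun T x => leafInsert x T) l)
        ((w.filter (a ≤ ·)).foldl (fun T x => leafInsert x T) r) := by
  induction w generalizing l r with
  | nil => rfl
  | cons x w ih =>
    rcases lt_or_ge x a with h | h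
    · simp [leafInsert, h, ih]
    · simp [leafInsert, h, h.not_gt, ih]

theorem leafTree_cons (a : ℕ) (w : List ℕ) :
    leafTree (a :: w) =
      .node a (leafTree (w.filter (· < a))) (leafTree (w.filter (a ≤ ·))) :=
  foldl_leafInsert_node a .nil .nil w

theorem lowerRestrict_leafTree (b : ℕ) (w : List ℕ) :
    lowerRestrict b (leafTree w) = leafTree (w.filter (· ≤ b)) := by
  induction hk : w.length using Nat.strong_induction_on generalizing w with
  | _ k ih =>
    cases w with
    | nil => rfl
    | cons x w =>
      have hlen : ∀ p : ℕ → Bool, (w.filter p).length < k := fun p => by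
        have := List.length_filter_le p w
        simp only [List.length_cons] at hk
        omega
      rw [leafTree_cons, lowerRestrict]
      split_ifs with h
      · rw [ih _ (hlen _) _ rfl, List.filter_cons_of_pos (by simpa using h), leafTree_cons]
        simp only [List.filter_filter]
        congr 2 <;> refine List.filter_congr fun y _ => ?_
        · simp only [← Bool.decide_and, decide_eq_decide]; omega
        · rw [Bool.and_comm]
      · rw [ih _ (hlen _) _ rfl, List.filter_cons_of_neg (by simpa using h), List.filter_filter]
        congr 1
        refine List.filter_congr fun y _ => ?_
        simp only [← Bool.decide_and, decide_eq_decide]; omega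

theorem higherRestrict_leafTree (b : ℕ) (w : List ℕ) :
    higherRestrict b (leafTree w) = leafTree (w.filter (b < ·)) := by
  induction hk : w.length using Nat.strong_induction_on generalizing w with
  | _ k ih =>
    cases w with
    | nil => rfl
    | cons x w =>
      have hlen : ∀ p : ℕ → Bool, (w.filter p).length < k := fun p => by
        have := List.length_filter_le p w
        simp only [List.length_cons] at hk
        omega
      rw [leafTree_cons, higherRestrict]
      split_ifs with h
      · rw [ih _ (hlen _) _ rfl, List.filter_cons_of_pos (by simpa using h), leafTree_cons]
        simp only [List.filter_filter]
        congr 2 <;> refine List.filter_congr fun y _ => ?_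
        · rw [Bool.and_comm]
        · simp only [← Bool.decide_and, decide_eq_decide]; omega
      · rw [ih _ (hlen _) _ rfl, List.filter_cons_of_neg (by simpa using h), List.filter_filter]
        congr 1
        refine List.filter_congr fun y _ => ?_
        simp only [← Bool.decide_and, decide_eq_decide]; omega

theorem pSymbol_eq (w : List ℕ) :
    pSymbol w = (leafTree w, w.foldl (fun T a => rootInsert a T) .nil) := by
  induction w using List.reverseRecOn with
  | nil => rfl
  | append_singleton w a ih =>
    simp only [pSymbol, leafTree, List.foldl_append, List.foldl_cons, List.foldl_nil] at ih ⊢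
    rw [ih]

/-- Root insertion puts the letter inserted last at the root, so that it builds, for a word without
repetitions, the tree that leaf insertion builds from the reversed word. -/
theorem foldl_rootInsert_eq {w : List ℕ} (hw : w.Nodup) :
    w.foldl (fun T a => rootInsert a T) .nil = leafTree w.reverse := by
  induction w using List.reverseRecOn with
  | nil => rfl
  | append_singleton w a ih =>
    rw [List.nodup_append_comm] at hw
    simp only [List.singleton_append, List.nodup_cons] at hw
    rw [List.foldl_append, ih hw.2]
    simp only [List.foldl_cons, List.foldl_nil, List.reverse_append, List.reverse_cons,
      List.reverse_nil, List.nil_append, List.singleton_append]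
    rw [leafTree_cons, rootInsert, lowerRestrict_leafTree, higherRestrict_leafTree]
    congr 2 <;> refine List.filter_congr fun y hy => ?_
    all_goals
      have : y ≠ a := fun h => hw.1 (by simpa [h] using hy)
      simp only [decide_eq_decide]
      omega

theorem numNodes_shape_leafTree (w : List ℕ) : (shape (leafTree w)).numNodes = w.length := by
  induction hk : w.length using Nat.strong_induction_on generalizing w with
  | _ k ih =>
    cases w with
    | nil => simpa [leafTree, shape, BinaryTree.map] using hk
    | cons x w =>
      have hlen : ∀ p : ℕ → Bool, (w.filter p).length < k := fun p => by
        have := List.length_filter_le p w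
        simp only [List.length_cons] at hk
        omega
      have h1 := ih _ (hlen _) (w.filter (· < x)) rfl
      have h2 := ih _ (hlen _) (w.filter (x ≤ ·)) rfl
      rw [shape] at h1 h2
      rw [leafTree_cons, shape, BinaryTree.map, BinaryTree.numNodes, h1, h2, ← hk,
        List.length_cons, List.length_eq_length_filter_add (l := w) (· < x)]
      congr 3
      refine List.filter_congr fun y _ => ?_
      simp only [← decide_not, not_lt]

/-! ### Ancestors -/

/-- The ancestor relation of a binary tree whose nodes are labeled in infix order by consecutive
numbers starting from `s`: the node `i` is an ancestor of the node `j`, or equal to it. -/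
def Anc : BinaryTree Unit → ℕ → ℕ → ℕ → Prop
  | .nil, _, _, _ => False
  | .node _ l r, s, i, j =>
    (i = s + l.numNodes ∧ s ≤ j ∧ j < s + (l.numNodes + r.numNodes + 1)) ∨
      Anc l s i j ∨ Anc r (s + l.numNodes + 1) i j

theorem Anc.bounds {T : BinaryTree Unit} {s i j : ℕ} (h : Anc T s i j) :
    (s ≤ i ∧ i < s + T.numNodes) ∧ (s ≤ j ∧ j < s + T.numNodes) := by
  induction T generalizing s with
  | nil => exact h.elim
  | node _ l r ihl ihr =>
    simp only [BinaryTree.numNodes]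
    rcases h with h | h | h
    · omega
    · have := ihl h
      omega
    · have := ihr h
      omega

theorem Anc.of_mem {T : BinaryTree Unit} {s i j k : ℕ} (h : Anc T s i j) (h1 : min i j ≤ k)
    (h2 : k ≤ max i j) : Anc T s i k := by
  induction T generalizing s with
  | nil => exact h.elim
  | node _ l r ihl ihr =>
    rcases h with h | h | h
    · exact .inl (by omega)
    · exact .inr (.inl (ihl h))
    · exact .inr (.inr (ihr h))

theorem Anc.antisymm {T : BinaryTree Unit} {s i j : ℕ} (h : Anc T s i j) (h' : Anc T s j i) :
    i = j := by
  induction T generalizing s with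
  | nil => exact h.elim
  | node _ l r ihl ihr =>
    rcases h with h | h | h <;> rcases h' with h' | h' | h'
    · omega
    · have := h'.bounds; omega
    · have := h'.bounds; omega
    · have := h.bounds; omega
    · exact ihl h h'
    · have := h.bounds; have := h'.bounds; omega
    · have := h.bounds; omega
    · have := h.bounds; have := h'.bounds; omega
    · exact ihr h h'

/-- A binary tree is determined by its size and its ancestor relation; inclusion of the ancestor
relations suffices, as the root is an ancestor of all the nodes. -/
theorem eq_of_anc_imp {T T' : BinaryTree Unit} {s : ℕ} (hn : T.numNodes = T'.numNodes)
    (h : ∀ i j, Anc T s i j → Anc T' s i j) : T = T' := by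
  induction T generalizing T' s with
  | nil =>
    cases T' with
    | nil => rfl
    | node => simp at hn
  | node _ l r ihl ihr =>
    cases T' with
    | nil => simp at hn
    | node _ l' r' =>
      simp only [BinaryTree.numNodes] at hn
      have hroot : l.numNodes = l'.numNodes := by
        rcases h (s + l.numNodes) (s + l'.numNodes) (.inl (by omega)) with h1 | h1 | h1
        · omega
        · have := h1.bounds; omega
        · have := h1.bounds; omega
      congr 1
      · refine ihl (s := s) hroot fun i j hij => ?_
        have hb := hij.bounds
        rcases h i j (.inr (.inl hij)) with h1 | h1 | h1
        · omega
        · exact h1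
        · have := h1.bounds; omega
      · refine ihr (s := s + l.numNodes + 1) (by omega) fun i j hij => ?_
        have hb := hij.bounds
        rcases h i j (.inr (.inr hij)) with h1 | h1 | h1
        · omega
        · have := h1.bounds; omega
        · rwa [hroot]

/-- In the binary search tree of a word on an interval of letters, `i` is an ancestor of `j` if and
only if `i` is the first letter of the word among the letters between `i` and `j`. -/
theorem anc_leafTree {w : List ℕ} {s m : ℕ} (hw : w.Nodup) (hmem : ∀ x, x ∈ w ↔ s ≤ x ∧ x < s + m)
    (i j : ℕ) (hi : s ≤ i ∧ i < s + m) (hj : s ≤ j ∧ j < s + m) :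
    Anc (shape (leafTree w)) s i j ↔
      w.find? (fun x => decide (min i j ≤ x ∧ x ≤ max i j)) = some i := by
  induction hk : w.length using Nat.strong_induction_on generalizing w s m with
  | _ k ih =>
    cases w with
    | nil => simpa using (hmem i).2 hi
    | cons a w =>
      have hlen : ∀ p : ℕ → Bool, (w.filter p).length < k := fun p => by
        have := List.length_filter_le p w
        simp only [List.length_cons] at hk
        omega
      rw [List.nodup_cons] at hw
      have ha := (hmem a).1 (by simp)
      have hlow : ∀ x, x ∈ w.filter (· < a) ↔ s ≤ x ∧ x < s + (a - s) := by
        intro x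
        have := hmem x
        simp only [List.mem_cons] at this
        simp only [List.mem_filter, decide_eq_true_eq]
        constructor
        · rintro ⟨h1, h2⟩
          have := this.1 (.inr h1)
          omega
        · intro h
          exact ⟨(this.2 (by omega)).resolve_left (by omega), by omega⟩
      have hhigh : ∀ x, x ∈ w.filter (a ≤ ·) ↔ a + 1 ≤ x ∧ x < a + 1 + (s + m - (a + 1)) := by
        intro x
        have := hmem x
        simp only [List.mem_cons] at this
        simp only [List.mem_filter, decide_eq_true_eq]
        constructor
        · rintro ⟨h1, h2⟩
          have := this.1 (.inr h1)
          have : x ≠ a := fun h => hw.1 (h ▸ h1)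
          omega
        · intro h
          exact ⟨(this.2 (by omega)).resolve_left (by omega), by omega⟩
      have hcard : ∀ (v : List ℕ) (b c : ℕ), v.Nodup → (∀ x, x ∈ v ↔ b ≤ x ∧ x < b + c) →
          v.length = c := by
        intro v b c hv h
        have : v.toFinset = Finset.Ico b (b + c) := by
          ext x
          simp [h]
        rw [← List.toFinset_card_of_nodup hv, this]
        simp
      have hl := numNodes_shape_leafTree (w.filter (· < a))
      have hr := numNodes_shape_leafTree (w.filter (a ≤ ·))
      rw [hcard _ _ _ (hw.2.filter _) hlow] at hl
      rw [hcard _ _ _ (hw.2.filter _) hhigh] at hr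
      have hshape : shape (leafTree (a :: w)) = .node () (shape (leafTree (w.filter (· < a))))
          (shape (leafTree (w.filter (a ≤ ·)))) := by
        rw [leafTree_cons]
        rfl
      rw [hshape, Anc, hl, hr]
      have e1 : s + (a - s) = a := by omega
      rw [e1]
      by_cases hin : min i j ≤ a ∧ a ≤ max i j
      · rw [List.find?_cons_of_pos (by simpa using hin), Option.some_inj]
        constructor
        · rintro (h | h | h)
          · exact h.1.symm
          · have := h.bounds; omega
          · have := h.bounds; omega
        · rintro rfl
          exact .inl (by omega)
      · rw [List.find?_cons_of_neg (by simpa using hin)]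
        by_cases hlt : max i j < a
        · have := ih _ (hlen _) (hw.2.filter _) hlow (by omega) (by omega) rfl
          have e2 : (w.filter (· < a)).find? (fun x => decide (min i j ≤ x ∧ x ≤ max i j)) =
              w.find? fun x => decide (min i j ≤ x ∧ x ≤ max i j) := by
            rw [List.find?_filter]
            congr 1
            ext x
            simp only [decide_eq_true_eq, decide_eq_decide]
            omega
          rw [e2] at this
          rw [← this]
          constructor
          · rintro (h | h | h)
            · omega
            · exact h
            · have := h.bounds; omega
          · exact fun h => .inr (.inl h)
        · have := ih _ (hlen _) (hw.2.filter _) hhigh (by omega) (by omega) rfl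
          have e2 : (w.filter (a ≤ ·)).find? (fun x => decide (min i j ≤ x ∧ x ≤ max i j)) =
              w.find? fun x => decide (min i j ≤ x ∧ x ≤ max i j) := by
            rw [List.find?_filter]
            congr 1
            ext x
            simp only [decide_eq_true_eq, decide_eq_decide]
            omega
          rw [e2] at this
          rw [← this]
          constructor
          · rintro (h | h | h)
            · omega
            · have := h.bounds; omega
            · exact h
          · exact fun h => .inr (.inr h)

/-! ### Canopies -/

theorem length_leafWord (o : Bool) (T : BinaryTree Unit) :
    (leafWord o T).length = T.numNodes + 1 := by
  induction T generalizing o with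
  | nil => rfl
  | node _ l r ihl ihr =>
    simp only [leafWord, List.length_append, ihl, ihr, BinaryTree.numNodes]
    omega

open scoped Classical in
/-- The leaf between the nodes `i` and `i + 1` is a left child if and only if `i` is an ancestor of
`i + 1`; the first leaf of a tree with at least one node is a left child and the last one is a right
child. -/
theorem leafWord_getElem? (o : Bool) (T : BinaryTree Unit) (s j : ℕ) (hj : j ≤ T.numNodes) :
    (leafWord o T)[j]? = some (if T.numNodes = 0 then o else if j = 0 then true else
      if j = T.numNodes then false else decide (Anc T s (s + j - 1) (s + j))) := by
  induction T generalizing o s j with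
  | nil =>
    obtain rfl : j = 0 := by simpa using hj
    simp [leafWord]
  | node v l r ihl ihr =>
    have hn : (BinaryTree.node v l r).numNodes = l.numNodes + r.numNodes + 1 := rfl
    rw [leafWord, List.getElem?_append, length_leafWord,
      if_neg (by omega : ¬ (BinaryTree.node v l r).numNodes = 0)]
    split_ifs with h1 h2 h3 h4
    · subst h2
      rw [ihl true s 0 (by omega)]
      simp
    · omega
    · rw [ihl true s j (by omega), if_neg (by omega), if_neg h2]
      split_ifs with h4
      · subst h4
        rw [Option.some_inj, eq_comm, decide_eq_false_iff_not]
        rintro (h | h | h)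
        · omega
        · have := h.bounds; omega
        · have := h.bounds; omega
      · rw [Option.some_inj, decide_eq_decide]
        constructor
        · exact fun h => .inr (.inl h)
        · rintro (h | h | h)
          · omega
          · exact h
          · have := h.bounds; omega
    · omega
    · rw [ihr false (s + l.numNodes + 1) _ (by omega)]
      split_ifs
      · rfl
      · omega
      · rfl
      · omega
    · rw [ihr false (s + l.numNodes + 1) _ (by omega), if_neg (by omega)]
      have e1 : s + l.numNodes + 1 + (j - (l.numNodes + 1)) = s + j := by omega
      rw [e1]
      split_ifs with h5 h6
      · rw [Option.some_inj, eq_comm, decide_eq_true_iff]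
        exact .inl (by omega)
      · omega
      · rw [Option.some_inj, decide_eq_decide]
        constructor
        · exact fun h => .inr (.inr h)
        · rintro (h | h | h)
          · omega
          · have := h.bounds; omega
          · exact h

theorem length_canopy (T : BinaryTree Unit) : (canopy T).length = T.numNodes - 1 := by
  simp [canopy, length_leafWord]

open scoped Classical in
theorem canopy_getElem (T : BinaryTree Unit) (s j : ℕ) (hj : j < (canopy T).length) :
    (canopy T)[j] = decide (Anc T s (s + j) (s + j + 1)) := by
  have hj' := hj
  rw [length_canopy] at hj'
  have h := leafWord_getElem? true T s (j + 1) (by omega)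
  rw [if_neg (by omega), if_neg (by omega), if_neg (by omega)] at h
  have h1 : j + 1 < (leafWord true T).length := by rw [length_leafWord]; omega
  rw [List.getElem?_eq_getElem h1, Option.some_inj] at h
  simp only [canopy, List.getElem_dropLast, List.getElem_tail, h]
  rfl

theorem forall₂_canopy_iff {T T' : BinaryTree Unit} (h : T.numNodes = T'.numNodes) (s : ℕ) :
    List.Forall₂ (· ≠ ·) (canopy T) (canopy T') ↔
      ∀ i, s ≤ i → i + 1 < s + T.numNodes → ¬ (Anc T s i (i + 1) ↔ Anc T' s i (i + 1)) := by
  classical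
  have hl : (canopy T).length = (canopy T').length := by rw [length_canopy, length_canopy, h]
  have hlen := length_canopy T
  rw [List.forall₂_iff_get]
  constructor
  · rintro ⟨-, H⟩ i h1 h2
    obtain ⟨j, rfl⟩ := Nat.exists_eq_add_of_le h1
    have := H j (by omega) (by omega)
    simpa only [List.get_eq_getElem, canopy_getElem _ s, ne_eq, decide_eq_decide] using this
  · refine fun H => ⟨hl, fun j h1 h2 => ?_⟩
    have := H (s + j) (by omega) (by omega)
    simpa only [List.get_eq_getElem, canopy_getElem _ s, ne_eq, decide_eq_decide] using this

/-! ### `P`-symbols of permutations -/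

theorem nodup_word (σ : Perm (Fin n)) : (word σ).Nodup := by
  refine List.nodup_ofFn.2 fun i j h => ?_
  exact σ.injective (Fin.ext (by simpa using h))

theorem mem_word (σ : Perm (Fin n)) (x : ℕ) : x ∈ word σ ↔ 1 ≤ x ∧ x < 1 + n := by
  rw [word, List.mem_ofFn]
  constructor
  · rintro ⟨i, rfl⟩
    omega
  · intro h
    exact ⟨σ.symm ⟨x - 1, by omega⟩, by simp; omega⟩

theorem reverse_word (σ : Perm (Fin n)) : (word σ).reverse = word (σ * Fin.revPerm) := by
  apply List.ext_getElem?
  intro m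
  by_cases hm : m < n
  · rw [word_getElem? _ ⟨m, hm⟩, List.getElem?_reverse (by rwa [length_word]), length_word]
    have := word_getElem? σ (Fin.rev ⟨m, hm⟩)
    rw [Fin.val_rev] at this
    simp only [Perm.mul_apply, Fin.revPerm_apply, ← this]
    congr 1
    omega
  · rw [List.getElem?_eq_none (by simp [length_word]; omega),
      List.getElem?_eq_none (by rw [length_word]; omega)]

theorem first_mul_revPerm (σ : Perm (Fin n)) (a c : Fin n) :
    First (σ * Fin.revPerm) a c ↔ Last σ a c := by
  have h : ∀ x, (σ * Fin.revPerm).symm x = (σ.symm x).rev := by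
    intro x
    rw [symm_apply_eq]
    simp
  simp only [First, Last, h, Fin.rev_le_rev]

theorem min_le_iff_val {a b c : Fin n} : min a c ≤ b ↔ min (a : ℕ) c ≤ b := by
  simp only [min_le_iff, Fin.le_def]

theorem le_max_iff_val {a b c : Fin n} : b ≤ max a c ↔ (b : ℕ) ≤ max (a : ℕ) c := by
  simp only [le_max_iff, Fin.le_def]

theorem find?_word_eq_some_iff (σ : Perm (Fin n)) (a c : Fin n) :
    (word σ).find? (fun x => decide (min ((a : ℕ) + 1) (c + 1) ≤ x ∧ x ≤ max ((a : ℕ) + 1) (c + 1)))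
      = some ((a : ℕ) + 1) ↔ First σ a c := by
  have hget : ∀ (m : ℕ) (hm : m < (word σ).length),
      (word σ)[m] = (σ ⟨m, by rwa [length_word] at hm⟩ : ℕ) + 1 := by
    intro m hm
    simp [word]
  rw [List.find?_eq_some_iff_getElem]
  constructor
  · rintro ⟨-, m, hm, h1, h2⟩ b hb hb'
    rw [min_le_iff_val] at hb
    rw [le_max_iff_val] at hb'
    rw [hget, add_left_inj] at h1
    have h1' := Fin.ext h1
    rw [← h1', symm_apply_apply]
    by_contra! h3
    have h4 := h2 (σ.symm b) (Fin.lt_def.1 h3)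
    rw [hget] at h4
    simp only [Fin.eta, apply_symm_apply, Bool.not_eq_true', decide_eq_false_iff_not] at h4
    omega
  · intro H
    refine ⟨by simp, σ.symm a, by simp [length_word], by simp [hget], fun m hm => ?_⟩
    rw [hget]
    simp only [Bool.not_eq_true', decide_eq_false_iff_not]
    intro h
    have := H (σ ⟨m, by omega⟩) (min_le_iff_val.2 (by omega)) (le_max_iff_val.2 (by omega))
    rw [symm_apply_apply, Fin.le_def] at this
    simp only at this
    omega

theorem anc_leafTree_word (σ : Perm (Fin n)) (a c : Fin n) :
    Anc (shape (leafTree (word σ))) 1 (a + 1) (c + 1) ↔ First σ a c := by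
  rw [anc_leafTree (nodup_word σ) (mem_word σ) _ _ (by omega) (by omega), find?_word_eq_some_iff]

/-- The left tree of the `P`-symbol is the binary search tree of the word, the right one is the
binary search tree of the reversed word. -/
theorem hasPSymbol_iff {σ : Perm (Fin n)} {J : TwinTrees n} :
    HasPSymbol σ J ↔ shape (leafTree (word σ)) = J.left ∧
      shape (leafTree (word (σ * Fin.revPerm))) = J.right := by
  rw [HasPSymbol, pSymbol_eq, foldl_rootInsert_eq (nodup_word σ), reverse_word]

theorem HasPSymbol.anc_left {σ : Perm (Fin n)} {J : TwinTrees n} (h : HasPSymbol σ J)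
    (a c : Fin n) : Anc J.left 1 (a + 1) (c + 1) ↔ First σ a c := by
  rw [← (hasPSymbol_iff.1 h).1, anc_leafTree_word]

theorem HasPSymbol.anc_right {σ : Perm (Fin n)} {J : TwinTrees n} (h : HasPSymbol σ J)
    (a c : Fin n) : Anc J.right 1 (a + 1) (c + 1) ↔ Last σ a c := by
  rw [← (hasPSymbol_iff.1 h).2, anc_leafTree_word, first_mul_revPerm]

/-- A tree with `n` nodes whose ancestor relation holds in the word of `σ` is the binary search
tree of this word. -/
theorem shape_leafTree_word_eq {σ : Perm (Fin n)} {T : BinaryTree Unit} (hT : T.numNodes = n)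
    (h : ∀ a c : Fin n, Anc T 1 (a + 1) (c + 1) → First σ a c) :
    shape (leafTree (word σ)) = T := by
  symm
  refine eq_of_anc_imp (s := 1) (by rw [numNodes_shape_leafTree, length_word, hT]) ?_
  intro i j hij
  have hb := hij.bounds
  obtain ⟨a, rfl⟩ : ∃ a : Fin n, i = a + 1 := ⟨⟨i - 1, by omega⟩, by simp; omega⟩
  obtain ⟨c, rfl⟩ : ∃ c : Fin n, j = c + 1 := ⟨⟨j - 1, by omega⟩, by simp; omega⟩
  exact (anc_leafTree_word σ a c).2 (h a c hij)

theorem HasPSymbol.of_baxterEquiv {σ τ : Perm (Fin n)} {J : TwinTrees n} (h : HasPSymbol σ J)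
    (h' : BaxterEquiv σ τ) : HasPSymbol τ J := by
  refine hasPSymbol_iff.2 ⟨shape_leafTree_word_eq J.left_numNodes fun a c hac => ?_,
    shape_leafTree_word_eq J.right_numNodes fun a c hac => ?_⟩
  · exact (h'.first_last a c).1.1 ((h.anc_left a c).1 hac)
  · exact (first_mul_revPerm τ a c).2 ((h'.first_last a c).2.1 ((h.anc_right a c).1 hac))

theorem HasPSymbol.unique {σ : Perm (Fin n)} {J J' : TwinTrees n} (h : HasPSymbol σ J)
    (h' : HasPSymbol σ J') : J = J' :=
  TwinTrees.ext (h.1.symm.trans h'.1) (h.2.symm.trans h'.2)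

theorem HasPSymbol.dataLe {σ τ : Perm (Fin n)} {J : TwinTrees n} (h : HasPSymbol σ J)
    (h' : HasPSymbol τ J) : DataLe σ τ := fun a c _ =>
  ⟨fun H => (h.anc_left a c).1 ((h'.anc_left a c).2 H),
    fun H => (h.anc_right c a).1 ((h'.anc_right c a).2 H)⟩

/-- The two trees of a `P`-symbol are twins: of two letters `a` and `a + 1`, one is the ancestor
of the other in the left tree if it is the first of the two in the word, and in the right tree if
it is the last one. -/
theorem exists_hasPSymbol (σ : Perm (Fin n)) : ∃ J : TwinTrees n, HasPSymbol σ J := by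
  refine ⟨⟨shape (leafTree (word σ)), shape (leafTree (word (σ * Fin.revPerm))), ?_, ?_, ?_⟩, ?_⟩
  · rw [numNodes_shape_leafTree, length_word]
  · rw [numNodes_shape_leafTree, length_word]
  · refine (forall₂_canopy_iff ?_ 1).2 ?_
    · simp only [numNodes_shape_leafTree, length_word]
    · intro i h1 h2
      rw [numNodes_shape_leafTree, length_word] at h2
      obtain ⟨a, ha⟩ : ∃ a : Fin n, i = (a : ℕ) + 1 := ⟨⟨i - 1, by omega⟩, by simp; omega⟩
      obtain ⟨c, hc⟩ : ∃ c : Fin n, i + 1 = (c : ℕ) + 1 := ⟨⟨i, by omega⟩, rfl⟩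
      have hac : a < c := Fin.lt_def.2 (by omega)
      have hmem : ∀ b : Fin n, min a c ≤ b → b ≤ max a c → b = a ∨ b = c := by
        intro b hb hb'
        rw [min_le_iff_val] at hb
        rw [le_max_iff_val] at hb'
        simp only [Fin.ext_iff]
        omega
      rw [hc, ha, anc_leafTree_word, anc_leafTree_word, first_mul_revPerm]
      have hne : σ.symm a ≠ σ.symm c := fun h => hac.ne (σ.symm.injective h)
      rcases lt_or_gt_of_ne hne with h | h
      · refine fun H => (H.1 fun b hb hb' => ?_) c (by simp) (by simp) |>.not_gt h
        rcases hmem b hb hb' with rfl | rfl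
        · exact le_rfl
        · exact h.le
      · refine fun H => (H.2 fun b hb hb' => ?_) c (by simp) (by simp) |>.not_gt h
        rcases hmem b hb hb' with rfl | rfl
        · exact le_rfl
        · exact h.le
  · exact hasPSymbol_iff.2 ⟨rfl, rfl⟩

/-- Every pair of twin binary trees is the `P`-symbol of a permutation. The inversions are the
transitive closure of the pairs `a < c` for which `c` is an ancestor of `a` in the left tree or `a`
is an ancestor of `c` in the right tree. A chain of such pairs that contradicts one of the trees
would give two consecutive letters with the same ancestor in both trees. -/
theorem exists_perm_hasPSymbol (J : TwinTrees n) : ∃ σ : Perm (Fin n), HasPSymbol σ J := by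
  have twin := (forall₂_canopy_iff (J.left_numNodes.trans J.right_numNodes.symm) 1).1 J.twin
  rw [J.left_numNodes] at twin
  obtain ⟨σ, hσ⟩ := exists_inv_iff_transGen (n := n)
    (r := fun a c => a < c ∧ (Anc J.left 1 (c + 1) (a + 1) ∨ Anc J.right 1 (a + 1) (c + 1)))
    (fun h => h.1) (by
      rintro a b c ⟨-, h | h⟩ hab hbc
      · exact .inr ⟨hbc, .inl (h.of_mem (by omega) (by omega))⟩
      · exact .inl ⟨hab, .inr (h.of_mem (by omega) (by omega))⟩)
  have left_inv : ∀ a c : Fin n, c < a → Anc J.left 1 (a + 1) (c + 1) → Inv σ c a :=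
    fun a c hac h => (hσ c a).2 (.single ⟨hac, .inl h⟩)
  have right_inv : ∀ a c : Fin n, a < c → Anc J.right 1 (a + 1) (c + 1) → Inv σ a c :=
    fun a c hac h => (hσ a c).2 (.single ⟨hac, .inr h⟩)
  have left_not_inv : ∀ a c : Fin n, a < c → Anc J.left 1 (a + 1) (c + 1) → ¬ Inv σ a c := by
    intro a c hac h hinv
    rw [hσ] at hinv
    -- the first link `(a, b)` of the chain contradicts the twin condition at `a` and `a + 1`
    obtain ⟨b, ⟨hab, hb⟩, hbc⟩ := Relation.TransGen.head'_iff.1 hinv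
    have hbc : b ≤ c := by
      rcases Relation.reflTransGen_iff_eq_or_transGen.1 hbc with rfl | hbc
      · exact le_rfl
      · exact (lt_of_transGen (fun h => h.1) hbc).le
    have hL : Anc J.left 1 (a + 1) (b + 1) := h.of_mem (by omega) (by omega)
    have hR := hb.resolve_left fun h' => by
      have := h'.antisymm hL
      omega
    exact twin (a + 1) (by omega) (by omega) (iff_of_true (hL.of_mem (by omega) (by omega))
      (hR.of_mem (by omega) (by omega)))
  have right_not_inv : ∀ a c : Fin n, c < a → Anc J.right 1 (a + 1) (c + 1) → ¬ Inv σ c a := by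
    intro a c hac h hinv
    rw [hσ] at hinv
    -- the last link `(b, a)` of the chain contradicts the twin condition at `a - 1` and `a`
    obtain ⟨b, hcb, hba, hb⟩ := Relation.TransGen.tail'_iff.1 hinv
    have hcb : c ≤ b := by
      rcases Relation.reflTransGen_iff_eq_or_transGen.1 hcb with rfl | hcb
      · exact le_rfl
      · exact (lt_of_transGen (fun h => h.1) hcb).le
    have hR : Anc J.right 1 (a + 1) (b + 1) := h.of_mem (by omega) (by omega)
    have hL := hb.resolve_right fun h' => by
      have := h'.antisymm hR
      omega
    have hR' : Anc J.right 1 (a + 1) a := hR.of_mem (by omega) (by omega)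
    have hL' : Anc J.left 1 (a + 1) a := hL.of_mem (by omega) (by omega)
    refine twin a (by omega) (by omega) (iff_of_false (fun h' => ?_) (fun h' => ?_))
    · have := h'.antisymm hL'
      omega
    · have := h'.antisymm hR'
      omega
  refine ⟨σ, hasPSymbol_iff.2 ⟨shape_leafTree_word_eq J.left_numNodes fun a c h b hb hb' => ?_,
    shape_leafTree_word_eq J.right_numNodes fun a c h => ?_⟩⟩
  · rw [min_le_iff_val] at hb
    rw [le_max_iff_val] at hb'
    have hab : Anc J.left 1 (a + 1) (b + 1) := h.of_mem (by omega) (by omega)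
    rcases lt_trichotomy a b with hlt | rfl | hlt
    · exact ((not_inv hlt).1 (left_not_inv a b hlt hab)).le
    · exact le_rfl
    · exact (left_inv a b hlt hab).2.le
  · rw [first_mul_revPerm]
    intro b hb hb'
    have hb₁ := min_le_iff_val.1 hb
    have hb₂ := le_max_iff_val.1 hb'
    have hab : Anc J.right 1 (a + 1) (b + 1) := h.of_mem (by omega) (by omega)
    rcases lt_trichotomy a b with hlt | rfl | hlt
    · exact (right_inv a b hlt hab).2.le
    · exact le_rfl
    · exact ((not_inv hlt).1 (right_not_inv a b hlt hab)).le

/-! ### The lattices -/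

/-- The lattice of permutations under the permutohedron order. -/
@[reducible]
noncomputable def permLattice (n : ℕ) : Lattice (Perm (Fin n)) where
  le := Le
  le_refl := Le.refl
  le_trans _ _ _ := Le.trans
  le_antisymm _ _ := Le.antisymm
  sup := sup
  le_sup_left := le_sup_left
  le_sup_right := le_sup_right
  sup_le _ _ _ := sup_le
  inf := inf
  inf_le_left := inf_le_left
  inf_le_right := inf_le_right
  le_inf _ _ _ := le_inf

/-- A permutation with the given `P`-symbol. -/
noncomputable def perm (J : TwinTrees n) : Perm (Fin n) := (exists_perm_hasPSymbol J).choose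

theorem hasPSymbol_perm (J : TwinTrees n) : HasPSymbol (perm J) J :=
  (exists_perm_hasPSymbol J).choose_spec

/-- The pair of twin binary trees that is the `P`-symbol of the given permutation. -/
noncomputable def twinTrees (σ : Perm (Fin n)) : TwinTrees n := (exists_hasPSymbol σ).choose

theorem hasPSymbol_twinTrees (σ : Perm (Fin n)) : HasPSymbol σ (twinTrees σ) :=
  (exists_hasPSymbol σ).choose_spec

/-- The order of the Baxter classes does not depend on the choice of representatives, whereas
`TwinLE` only asks for some comparable ones. -/
theorem dataLe_iff_twinLE {σ₀ σ₁ : Perm (Fin n)} {J₀ J₁ : TwinTrees n} (h₀ : HasPSymbol σ₀ J₀)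
    (h₁ : HasPSymbol σ₁ J₁) : DataLe σ₀ σ₁ ↔ TwinLE J₀ J₁ := by
  constructor
  · intro h
    obtain ⟨τ, h2, h3⟩ := h.exists_le
    exact ⟨σ₀, τ, h₀, h₁.of_baxterEquiv h2.symm, permLE_iff_le.2 h3⟩
  · rintro ⟨τ₀, τ₁, h2, h3, h4⟩
    exact ((h₀.dataLe h2).trans (permLE_iff_le.1 h4).dataLe).trans (h3.dataLe h₁)

/-- The lattice of pairs of twin binary trees. Join and meet are computed on representatives. -/
@[reducible]
noncomputable def twinLattice (n : ℕ) : Lattice (TwinTrees n) where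
  le := TwinLE
  le_refl J := ⟨perm J, perm J, hasPSymbol_perm J, hasPSymbol_perm J, .refl⟩
  le_trans J₀ J₁ J₂ h h' := by
    rw [← dataLe_iff_twinLE (hasPSymbol_perm _) (hasPSymbol_perm _)] at *
    exact h.trans h'
  le_antisymm J₀ J₁ h h' := by
    rw [← dataLe_iff_twinLE (hasPSymbol_perm _) (hasPSymbol_perm _)] at h h'
    exact ((hasPSymbol_perm J₀).of_baxterEquiv (h.antisymm h')).unique (hasPSymbol_perm J₁)
  sup J₀ J₁ := twinTrees (sup (perm J₀) (perm J₁))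
  le_sup_left J₀ J₁ := (dataLe_iff_twinLE (hasPSymbol_perm _) (hasPSymbol_twinTrees _)).1
    (le_sup_left _ _).dataLe
  le_sup_right J₀ J₁ := (dataLe_iff_twinLE (hasPSymbol_perm _) (hasPSymbol_twinTrees _)).1
    (le_sup_right _ _).dataLe
  sup_le J₀ J₁ J₂ h h' := by
    rw [← dataLe_iff_twinLE (hasPSymbol_perm _) (hasPSymbol_perm _)] at h h'
    exact (dataLe_iff_twinLE (hasPSymbol_twinTrees _) (hasPSymbol_perm _)).1 (dataLe_sup h h')
  inf J₀ J₁ := twinTrees (inf (perm J₀) (perm J₁))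
  inf_le_left J₀ J₁ := (dataLe_iff_twinLE (hasPSymbol_twinTrees _) (hasPSymbol_perm _)).1
    (inf_le_left _ _).dataLe
  inf_le_right J₀ J₁ := (dataLe_iff_twinLE (hasPSymbol_twinTrees _) (hasPSymbol_perm _)).1
    (inf_le_right _ _).dataLe
  le_inf J₀ J₁ J₂ h h' := by
    rw [← dataLe_iff_twinLE (hasPSymbol_perm _) (hasPSymbol_perm _)] at h h'
    exact (dataLe_iff_twinLE (hasPSymbol_perm _) (hasPSymbol_twinTrees _)).1 (dataLe_inf h h')

end Baxter

theorem mainTheorem7 (n : ℕ) :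
    (∃ L : Lattice (Baxter.TwinTrees n),
      ∀ J₀ J₁ : Baxter.TwinTrees n, L.le J₀ J₁ ↔ Baxter.TwinLE J₀ J₁) ∧
    (∃ L : Lattice (Equiv.Perm (Fin n)),
      (∀ σ ν : Equiv.Perm (Fin n), L.le σ ν ↔ Baxter.PermLE σ ν) ∧
      ∃ c : @LatticeCon (Equiv.Perm (Fin n)) L,
        ∀ σ ν : Equiv.Perm (Fin n), c.r σ ν ↔ Baxter.PermEquiv σ ν) := by
  refine ⟨⟨Baxter.twinLattice n, fun _ _ => .rfl⟩, Baxter.permLattice n,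
    fun _ _ => Baxter.permLE_iff_le.symm, ?_⟩
  let _ := Baxter.permLattice n
  exact ⟨{ r := Baxter.BaxterEquiv
           iseqv := Relation.EqvGen.is_equivalence _
           inf := Baxter.BaxterEquiv.inf
           sup := Baxter.BaxterEquiv.sup }, fun _ _ => Baxter.permEquiv_iff_baxterEquiv.symm⟩
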